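/- For a finite group $G$ and a subset $S\subseteq G\setminus\{1\}$ with $S=S^{-1}$, let $\mathrm{Cay}(G,S)$ be the graph with vertex set $G$ in which $x,y$ are adjacent if and only if $xy^{-1}\in S$. Two finite graphs are cospectral if their adjacency matrices have the same multiset of eigenvalues. A finite group $G$ is Cay-DS if every Cayley graph $\mathrm{Cay}(G,S)$ over $G$ is isomorphic to every Cayley graph $\mathrm{Cay}(H,T)$, over any finite group $H$, that is cospectral to it. For a prime $p$ let $D_{2p}$ be the dihedral group with $2p$ elements (so $D_4\cong C_2\times C_2$). Theorem. Let $p$ be a prime. Then $D_{2p}$ is Cay-DS if and only if $p\in\{2,3,5,7,11\}$. Moreover, if $p\ge 13$ and $a,b\in D_{2p}$ are any elements of orders $2$ and $p$, respectively, then the sets $$S=\{a,ab,ab^2,ab^6,ab^8,ab^{11}\},\qquad T=\{a,ab^2,ab^4,ab^5,ab^{10},ab^{11}\}$$ consist of reflections (in particular $S=S^{-1}$, $T=T^{-1}$ and $1\notin S\cup T$), and $\mathrm{Cay}(D_{2p},S)$ and $\mathrm{Cay}(D_{2p},T)$ are cospectral, non-isomorphic, $6$-regular graphs. -/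

import Mathlib

/-- Admissible connection sets of undirected Cayley graphs:
`1 ∉ S` and `S = S⁻¹`. -/
structure IsConnectionSet {G : Type*} [Group G] (S : Set G) : Prop where
  one_notMem : (1 : G) ∉ S
  inv_mem : ∀ g ∈ S, g⁻¹ ∈ S

/-- The Cayley graph `Cay(G, S)`: the vertices are the elements of `G`, and `x`, `y` are adjacent
when `x * y⁻¹ ∈ S`. (For an arbitrary set `S` this is made irreflexive and symmetric; for a
connection set nothing has to be changed, see `cayleyGraph_adj`.) -/
def cayleyGraph {G : Type*} [Group G] (S : Set G) : SimpleGraph G :=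
  SimpleGraph.fromRel (fun x y => x * y⁻¹ ∈ S)

theorem cayleyGraph_adj {G : Type*} [Group G] {S : Set G} (hS : IsConnectionSet S) (x y : G) :
    (cayleyGraph S).Adj x y ↔ x * y⁻¹ ∈ S := by
  simp only [cayleyGraph, SimpleGraph.fromRel_adj]
  constructor
  · rintro ⟨-, h | h⟩
    · exact h
    · simpa using hS.inv_mem _ h
  · intro h
    refine ⟨?_, Or.inl h⟩
    rintro rfl
    exact hS.one_notMem (by simpa using h)

noncomputable instance cayleyGraph_decidableRel {G : Type*} [Group G] (S : Set G) :
    DecidableRel (cayleyGraph S).Adj :=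
  Classical.decRel _

open Classical in
/-- The adjacency spectrum of a finite graph: the multiset of eigenvalues, with multiplicity, of
its adjacency matrix. The matrix is real symmetric, so all its eigenvalues are real. -/
noncomputable def adjSpectrum {V : Type*} [Fintype V] (Γ : SimpleGraph V) : Multiset ℝ :=
  (Γ.adjMatrix ℝ).charpoly.roots

/-- Two finite graphs are cospectral if they have the same adjacency spectrum. -/
def Cospectral {V W : Type*} [Fintype V] [Fintype W]
    (Γ : SimpleGraph V) (Γ' : SimpleGraph W) : Prop :=
  adjSpectrum Γ = adjSpectrum Γ'

universe u

/-- A finite group `G` is Cay-DS if every Cayley graph over `G` is isomorphic to every Cayley graph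
(over any finite group `H`) that is cospectral to it. -/
def IsCayDS (G : Type u) [Group G] [Fintype G] : Prop :=
  ∀ S : Set G, IsConnectionSet S →
    ∀ (H : Type u) [Group H] [Fintype H] (T : Set H), IsConnectionSet T →
      Cospectral (cayleyGraph S) (cayleyGraph T) →
        Nonempty (cayleyGraph S ≃g cayleyGraph T)

/-! For `p ≥ 13` the two index sets `{0, 1, 2, 6, 8, 11}` and `{0, 2, 4, 5, 10, 11}` are homometric:
they have the same multiset of differences, already in `ℤ`. A Cayley graph given by reflections is
bipartite with biadjacency matrix a circulant `Q`, and its characteristic polynomial depends only on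
`Q * Qᵀ`, which counts differences (`cospectral_reflectionSet`). Non-isomorphism comes from counting
common neighbours among the neighbours of a vertex (`IsConnectionSet.isEmpty_iso`); beyond `23`
nothing wraps around modulo `p`, so one computation serves all those primes.

For small `p`, a cospectral Cayley graph has `2 * p` vertices, and every Cayley graph over a group
of order `2 * p` is one over the dihedral group (`exists_dihedral_iso`). The case `p = 2` is settled
by the degree. For `p = 3, 5, 7, 11` a finite check shows that equal numbers of closed walks of
lengths up to `11` force the connection sets to be related by affine automorphisms
(`Cospectral.nonempty_iso_of_masks`). The check is feasible because
`trace_adjMatrix_cayleyGraph_pow` computes these numbers by integer arithmetic: the circulant blocks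
are packed into integers in base `2 ^ 64` modulo `2 ^ (64 * p) - 1`. -/

/-! ### Spectra and numbers of closed walks -/

theorem Matrix.IsHermitian.sum_roots_charpoly_pow {n : Type*} [Fintype n] [DecidableEq n]
    {A : Matrix n n ℝ} (hA : A.IsHermitian) (k : ℕ) :
    (A.charpoly.roots.map (· ^ k)).sum = (A ^ k).trace := by
  rw [hA.roots_charpoly_eq_eigenvalues]
  conv_rhs => rw [hA.spectral_theorem]
  rw [← map_pow, Unitary.conjStarAlgAut_apply, Matrix.trace_mul_comm, ← mul_assoc]
  simp [Matrix.diagonal_pow, Matrix.trace_diagonal, Finset.sum_map_val]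

namespace SimpleGraph

theorem isHermitian_adjMatrix_real {V : Type*} (Γ : SimpleGraph V) [DecidableRel Γ.Adj] :
    (Γ.adjMatrix ℝ).IsHermitian := by
  rw [Matrix.IsHermitian, Matrix.conjTranspose_eq_transpose_of_trivial]
  exact Γ.transpose_adjMatrix

theorem adjSpectrum_eq {V : Type*} [Fintype V] [DecidableEq V] (Γ : SimpleGraph V) [DecidableRel Γ.Adj] :
    adjSpectrum Γ = (Γ.adjMatrix ℝ).charpoly.roots := by
  unfold adjSpectrum
  congr! 2
  ext x y
  simp [adjMatrix_apply]

theorem adjMatrix_reindex {V W R : Type*} [Zero R] [One R] {Γ : SimpleGraph V} {Γ' : SimpleGraph W}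
    [DecidableRel Γ.Adj] [DecidableRel Γ'.Adj] (e : Γ ≃g Γ') :
    Matrix.reindex e.toEquiv e.toEquiv (Γ.adjMatrix R) = Γ'.adjMatrix R := by
  ext x y
  simp only [Matrix.reindex_apply, Matrix.submatrix_apply, adjMatrix_apply]
  have h : Γ.Adj (e.toEquiv.symm x) (e.toEquiv.symm y) ↔ Γ'.Adj x y := by
    rw [← e.map_rel_iff]
    exact iff_of_eq (congrArg₂ _ (e.apply_symm_apply x) (e.apply_symm_apply y))
  simp only [h]

variable {V W : Type*} [Fintype V] [Fintype W]

theorem Iso.cospectral {Γ : SimpleGraph V} {Γ' : SimpleGraph W} (e : Γ ≃g Γ') :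
    Cospectral Γ Γ' := by
  classical
  rw [Cospectral, adjSpectrum_eq, adjSpectrum_eq, ← adjMatrix_reindex e, Matrix.charpoly_reindex]

theorem card_adjSpectrum (Γ : SimpleGraph V) : (adjSpectrum Γ).card = Fintype.card V := by
  classical
  rw [adjSpectrum_eq, (isHermitian_adjMatrix_real Γ).roots_charpoly_eq_eigenvalues]
  simp

theorem trace_adjMatrix_pow [DecidableEq V] (Γ : SimpleGraph V) [DecidableRel Γ.Adj] (k : ℕ) :
    (((Γ.adjMatrix ℕ ^ k).trace : ℕ) : ℝ) = ((adjSpectrum Γ).map (· ^ k)).sum := by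
  rw [adjSpectrum_eq, (isHermitian_adjMatrix_real Γ).sum_roots_charpoly_pow]
  have : Γ.adjMatrix ℝ = (Γ.adjMatrix ℕ).map (Nat.castRingHom ℝ) := by
    ext x y
    simp [adjMatrix_apply]
  rw [this, ← Matrix.map_pow]
  simp [Matrix.trace]

end SimpleGraph

namespace Cospectral

variable {V W : Type*} [Fintype V] [Fintype W] {Γ : SimpleGraph V} {Γ' : SimpleGraph W}

theorem card_eq (h : Cospectral Γ Γ') : Fintype.card V = Fintype.card W := by
  rw [← Γ.card_adjSpectrum, ← Γ'.card_adjSpectrum, show adjSpectrum Γ = _ from h]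

theorem trace_pow_eq [DecidableEq V] [DecidableEq W] [DecidableRel Γ.Adj] [DecidableRel Γ'.Adj]
    (h : Cospectral Γ Γ') (k : ℕ) :
    (Γ.adjMatrix ℕ ^ k).trace = (Γ'.adjMatrix ℕ ^ k).trace := by
  have := (SimpleGraph.trace_adjMatrix_pow Γ k).trans ((congrArg (fun s => (s.map (· ^ k)).sum) h).trans (SimpleGraph.trace_adjMatrix_pow Γ' k).symm)
  exact_mod_cast this

end Cospectral

/-! ### Cayley graphs over groups of order `2 * p` -/

section Cayley

variable {G H : Type*} [Group G] [Group H]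

/-- A group isomorphism carries Cayley graphs to Cayley graphs. -/
def cayleyGraphIsoOfMulEquiv (e : G ≃* H) {S : Set G} {T : Set H} (h : ∀ g, e g ∈ T ↔ g ∈ S) :
    cayleyGraph S ≃g cayleyGraph T where
  toEquiv := e.toEquiv
  map_rel_iff' := by
    intro x y
    simp only [cayleyGraph, SimpleGraph.fromRel_adj, MulEquiv.toEquiv_eq_coe, EquivLike.coe_coe,
      ← map_inv, ← map_mul, h, ne_eq, EmbeddingLike.apply_eq_iff_eq]

/-- Right translations are automorphisms of Cayley graphs. -/
def cayleyGraphRightMul (S : Set G) (g : G) : cayleyGraph S ≃g cayleyGraph S where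
  toEquiv := Equiv.mulRight g
  map_rel_iff' := by
    intro x y
    simp [cayleyGraph, SimpleGraph.fromRel_adj, mul_assoc]

open DihedralGroup in
/-- A Cayley graph over a group whose index-two subgroup `c(ZMod p)` is centralised by some element
outside it, or over a generalised dihedral group, is a Cayley graph over the dihedral group. -/
theorem exists_dihedral_iso_of_hom [Fintype H] {p : ℕ} [NeZero p] (hcard : Fintype.card H = 2 * p)
    (c : Multiplicative (ZMod p) →* H) (hc : Function.Injective c) (t : H)
    (ht : t ∉ Set.range c)
    (hcomm : (∀ i, t * c i = c i * t) ∨ (t * t = 1 ∧ ∀ i, t * c i = c i⁻¹ * t))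
    {T : Set H} (hT : IsConnectionSet T) :
    ∃ S : Set (DihedralGroup p), IsConnectionSet S ∧ Nonempty (cayleyGraph S ≃g cayleyGraph T) := by
  have cadd : ∀ i j : ZMod p, c (.ofAdd (i + j)) = c (.ofAdd i) * c (.ofAdd j) := fun i j => by
    rw [ofAdd_add, map_mul]
  have cneg : ∀ i : ZMod p, c (.ofAdd (-i)) = (c (.ofAdd i))⁻¹ := fun i => by
    rw [ofAdd_neg, map_inv]
  let f : DihedralGroup p → H
    | r i => c (.ofAdd i)
    | sr i => t * c (.ofAdd i)
  have finj : Function.Injective f := by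
    rintro (i | i) (j | j) h <;> simp only [f] at h
    · simpa using hc h
    · exact absurd ⟨.ofAdd (i - j), by rw [sub_eq_add_neg, cadd, cneg, h]; group⟩ ht
    · exact absurd ⟨.ofAdd (j - i), by rw [sub_eq_add_neg, cadd, cneg, ← h]; group⟩ ht
    · simpa using hc (mul_left_cancel h)
  have fbij : Function.Bijective f :=
    (Fintype.bijective_iff_injective_and_card f).2 ⟨finj, by rw [hcard, DihedralGroup.card]⟩
  have inv_iff : ∀ g, g⁻¹ ∈ T ↔ g ∈ T := fun g =>
    ⟨fun h => by simpa using hT.inv_mem _ h, hT.inv_mem g⟩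
  have f1 : f 1 = 1 := by
    rw [one_def]
    simp only [f]
    rw [ofAdd_zero, map_one]
  -- If `t` centralises the range of `c`, then `f` need not be a homomorphism; but `f x * (f y)⁻¹`
  -- is `f (x * y⁻¹)` or its inverse, and `T` is closed under inversion. In the other case `f` is a
  -- group isomorphism.
  have key : ∀ x y, f x * (f y)⁻¹ ∈ T ↔ f (x * y⁻¹) ∈ T := by
    rcases hcomm with hcomm | ⟨htt, hcomm⟩
    · have ccomm : ∀ i j, c i * c j = c j * c i := fun i j => by rw [← map_mul, mul_comm, map_mul]
      rintro (i | i) (j | j) <;>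
        simp only [f, inv_r, inv_sr, r_mul_r, r_mul_sr, sr_mul_r, sr_mul_sr]
      · rw [cadd, cneg]
      · rw [← inv_iff, sub_eq_add_neg, cadd, cneg]
        simp only [mul_inv_rev, inv_inv, mul_assoc]
      · rw [cadd, cneg, mul_assoc]
      · rw [← inv_iff, sub_eq_add_neg, cadd, cneg, hcomm]
        simp only [mul_inv_rev, inv_inv, mul_assoc, hcomm]
        rw [mul_inv_cancel_left]
    · have ht' : t⁻¹ = t := inv_eq_of_mul_eq_one_right htt
      have hcomm' : ∀ i, c i * t = t * c i⁻¹ := fun i => by rw [hcomm, inv_inv]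
      rintro (i | i) (j | j) <;>
        simp only [f, inv_r, inv_sr, r_mul_r, r_mul_sr, sr_mul_r, sr_mul_sr]
      · rw [cadd, cneg]
      · rw [mul_inv_rev, ht', ← mul_assoc, ← cneg, ← cadd, hcomm', ← ofAdd_neg]
        simp [sub_eq_add_neg]
      · rw [cadd, cneg, mul_assoc]
      · rw [mul_inv_rev, ht', ← mul_assoc, mul_assoc t, ← cneg, ← cadd, mul_assoc, hcomm',
          ← mul_assoc, htt, one_mul, ← ofAdd_neg]
        simp [sub_eq_add_neg]
  have hS : IsConnectionSet (f ⁻¹' T) := by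
    refine ⟨by simpa [f1] using hT.one_notMem, fun g hg => ?_⟩
    have := (key 1 g).1
    rw [f1, one_mul, one_mul] at this
    exact this (hT.inv_mem _ hg)
  refine ⟨f ⁻¹' T, hS, ⟨⟨Equiv.ofBijective f fbij, ?_⟩⟩⟩
  intro x y
  rw [cayleyGraph_adj hS, cayleyGraph_adj hT]
  exact key x y

/-- A subgroup of order `p` has index two, so it is normal and an outside element `t` acts on it as
multiplication by some `m`. Since `t * t` lies in this abelian subgroup, `m * m = 1`, so `m = 1` or
`m = -1`. If `m = -1 ≠ 1`, then `t * t` is fixed by conjugation by `t` and also inverted by it,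
hence trivial. -/
theorem exists_dihedral_iso [Fintype H] {p : ℕ} [hp : Fact p.Prime]
    (hcard : Fintype.card H = 2 * p) {T : Set H} (hT : IsConnectionSet T) :
    ∃ S : Set (DihedralGroup p), IsConnectionSet S ∧ Nonempty (cayleyGraph S ≃g cayleyGraph T) := by
  obtain ⟨b, hb⟩ := exists_prime_orderOf_dvd_card p (G := H) (by rw [hcard]; exact ⟨2, by ring⟩)
  have hN : Nat.card (Subgroup.zpowers b) = p := by rw [Nat.card_zpowers, hb]
  have hindex : (Subgroup.zpowers b).index = 2 := by
    have := (Subgroup.zpowers b).card_mul_index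
    rw [hN, Nat.card_eq_fintype_card, hcard, mul_comm 2] at this
    exact Nat.eq_of_mul_eq_mul_left hp.out.pos this
  have hnormal := Subgroup.normal_of_index_eq_two hindex
  obtain ⟨e⟩ : Nonempty (Multiplicative (ZMod p) ≃* Subgroup.zpowers b) := by
    have : ∀ q, Nat.card (Subgroup.zpowers b) = q →
        Nonempty (Multiplicative (ZMod q) ≃* Subgroup.zpowers b) := by
      rintro _ rfl
      exact ⟨zmodCyclicMulEquiv inferInstance⟩
    exact this p hN
  let c : Multiplicative (ZMod p) →* H := (Subgroup.zpowers b).subtype.comp e.toMonoidHom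
  have hc : Function.Injective c := Subtype.val_injective.comp e.injective
  have hrange : ∀ x, x ∈ Set.range c ↔ x ∈ Subgroup.zpowers b := by
    intro x
    constructor
    · rintro ⟨i, rfl⟩
      exact (e i).2
    · intro hx
      exact ⟨e.symm ⟨x, hx⟩, by simp [c]⟩
  obtain ⟨t, ht⟩ : ∃ t, t ∉ Subgroup.zpowers b := by
    by_contra! h
    have := Subgroup.index_eq_one.2 ((Subgroup.eq_top_iff' _).2 h)
    omega
  have hpow : ∀ i m : ZMod p, c (.ofAdd (i * m)) = c (.ofAdd m) ^ i.val := by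
    intro i m
    rw [← map_pow, ← ofAdd_nsmul, nsmul_eq_mul, ZMod.natCast_val, ZMod.cast_id', id]
  obtain ⟨m, hm⟩ := (hrange (t * c (.ofAdd 1) * t⁻¹)).2
    (hnormal.conj_mem _ ((hrange _).1 ⟨_, rfl⟩) t)
  obtain ⟨k, hk⟩ := (hrange (t * t)).2 (Subgroup.mul_self_mem_of_index_two hindex t)
  obtain ⟨m, rfl⟩ := Multiplicative.ofAdd.surjective m
  obtain ⟨k, rfl⟩ := Multiplicative.ofAdd.surjective k
  have hconj : ∀ i : ZMod p, t * c (.ofAdd i) * t⁻¹ = c (.ofAdd (i * m)) := by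
    intro i
    rw [hpow, hm, conj_pow, ← hpow, mul_one]
  have hmm : m * m = 1 := by
    have h1 : t * (t * c (.ofAdd 1) * t⁻¹) * t⁻¹ = c (.ofAdd 1) := by
      have : t * (t * c (.ofAdd 1) * t⁻¹) * t⁻¹ = (t * t) * c (.ofAdd 1) * (t * t)⁻¹ := by group
      rw [this, ← hk, ← map_mul, mul_comm, map_mul]
      group
    rw [← hm, hconj] at h1
    simpa using hc h1
  refine exists_dihedral_iso_of_hom hcard c hc t (fun h => ht ((hrange t).1 h)) ?_ hT
  by_cases h1 : m = 1
  · left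
    intro i
    obtain ⟨i, rfl⟩ := Multiplicative.ofAdd.surjective i
    have := hconj i
    rwa [h1, mul_one, mul_inv_eq_iff_eq_mul] at this
  · have h2 : m = -1 := (mul_self_eq_one_iff.1 hmm).resolve_left h1
    have h20 : (2 : ZMod p) ≠ 0 := fun h => h1 (by
      rw [h2, neg_eq_iff_add_eq_zero, ← h]; norm_num)
    right
    constructor
    · have h3 := hconj k
      rw [hk, show t * (t * t) * t⁻¹ = t * t by group, ← hk] at h3
      have h4 : k = k * m := by simpa using hc h3
      have h5 : k = 0 := by
        rw [h2] at h4
        have : (2 : ZMod p) * k = 0 := by linear_combination h4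
        exact (mul_eq_zero.1 this).resolve_left h20
      rw [← hk, h5, ofAdd_zero, map_one]
    · intro i
      obtain ⟨i, rfl⟩ := Multiplicative.ofAdd.surjective i
      have := hconj i
      rwa [h2, mul_neg, mul_one, ofAdd_neg, mul_inv_eq_iff_eq_mul] at this

end Cayley

/-! ### Powers of block circulants and their evaluation at characters -/

/-- The pair `(u, v)` with `(a + t) ^ k = u + v * t` whenever `t ^ 2 = b` and everything commutes. -/
def binomialPair {R : Type*} [Semiring R] (a b : R) : ℕ → R × R
  | 0 => (1, 0)
  | k + 1 => ((binomialPair a b k).1 * a + (binomialPair a b k).2 * b,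
      (binomialPair a b k).1 + (binomialPair a b k).2 * a)

namespace Matrix

variable {n R : Type*} [Fintype n] [DecidableEq n]

/-- The antidiagonal part squares to the block scalar `B * C` and commutes with the diagonal part,
so the power expands as in a quadratic extension. -/
theorem fromBlocks_pow_of_commute [Semiring R] {P B C : Matrix n n R} (hB : B * P = P * B)
    (hC : C * P = P * C) (hBC : C * B = B * C) (k : ℕ) :
    fromBlocks P B C P ^ k =
      fromBlocks (binomialPair P (B * C) k).1 ((binomialPair P (B * C) k).2 * B)
        ((binomialPair P (B * C) k).2 * C) (binomialPair P (B * C) k).1 := by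
  induction k with
  | zero => simp [binomialPair, fromBlocks_one]
  | succ k ih =>
    rw [pow_succ, ih, fromBlocks_multiply]
    simp only [binomialPair, add_mul, Matrix.mul_assoc, hB, hC, hBC]
    rw [add_comm (_ * (P * C))]
    congr 1
    rw [add_comm]

theorem exists_circulant_binomialPair [CommSemiring R] [AddCommGroup n] (f g : n → R) (k : ℕ) :
    (∃ u, (binomialPair (circulant f) (circulant g) k).1 = circulant u) ∧
      ∃ v, (binomialPair (circulant f) (circulant g) k).2 = circulant v := by
  induction k with
  | zero =>
    exact ⟨⟨Pi.single 0 1, (circulant_single_one R n).symm⟩, ⟨0, (circulant_zero R n).symm⟩⟩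
  | succ k ih =>
    obtain ⟨⟨u, hu⟩, v, hv⟩ := ih
    simp only [binomialPair, hu, hv, circulant_mul, ← circulant_add]
    exact ⟨⟨_, rfl⟩, _, rfl⟩

theorem vecMul_binomialPair [CommSemiring R] {P W : Matrix n n R} {e : n → R} {a b : R}
    (hP : e ᵥ* P = a • e) (hW : e ᵥ* W = b • e) (k : ℕ) :
    e ᵥ* (binomialPair P W k).1 = (binomialPair a b k).1 • e ∧
      e ᵥ* (binomialPair P W k).2 = (binomialPair a b k).2 • e := by
  induction k with
  | zero => simp [binomialPair]
  | succ k ih =>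
    simp only [binomialPair, vecMul_add, ← vecMul_vecMul, ih.1, ih.2, smul_vecMul, hP, hW,
      add_smul, mul_smul, and_self]

/-- A character is a common left eigenvector of all circulants. The coefficient ring is arbitrary
because the character used below takes values in `ZMod (2 ^ (64 * p) - 1)`. -/
theorem vecMul_circulant_of_map_add {n R : Type*} [Fintype n] [CommSemiring R] [AddCommGroup n] {e : n → R}
    (he : ∀ i j, e (i + j) = e i * e j) (f : n → R) :
    e ᵥ* circulant f = (∑ i, e i * f i) • e := by
  ext j
  simp only [vecMul, dotProduct, circulant_apply, Pi.smul_apply, smul_eq_mul, Finset.sum_mul]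
  refine Fintype.sum_equiv (Equiv.subRight j) _ _ fun i => ?_
  rw [Equiv.subRight_apply, mul_right_comm, ← he, sub_add_cancel]

/-- This crude bound on walk counts keeps each of them within one digit in base `2 ^ 64`. -/
theorem pow_apply_le_card_pow {M : Matrix n n ℕ} (hM : ∀ i j, M i j ≤ 1) (k : ℕ) (i j : n) :
    (M ^ k) i j ≤ Fintype.card n ^ k := by
  induction k generalizing j with
  | zero =>
    rw [pow_zero, pow_zero, one_apply]
    split_ifs <;> simp
  | succ k ih =>
    rw [pow_succ, mul_apply]
    calc ∑ l, (M ^ k) i l * M l j ≤ ∑ _l : n, Fintype.card n ^ k :=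
          Finset.sum_le_sum fun l _ => by simpa using Nat.mul_le_mul (ih l) (hM l j)
      _ = Fintype.card n ^ (k + 1) := by simp [pow_succ, mul_comm]

theorem map_binomialPair {S : Type*} [Semiring R] [Semiring S] (φ : R →+* S)
    (P W : Matrix n n R) (k : ℕ) :
    (binomialPair P W k).1.map φ = (binomialPair (P.map φ) (W.map φ) k).1 ∧
      (binomialPair P W k).2.map φ = (binomialPair (P.map φ) (W.map φ) k).2 := by
  induction k with
  | zero => simp [binomialPair]
  | succ k ih =>
    simp only [binomialPair, Matrix.map_add φ (map_add φ), Matrix.map_mul, ih.1, ih.2, and_self]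

theorem trace_reindex_pow {m : Type*} [Fintype m] [DecidableEq m] [Semiring R] (e : m ≃ n)
    (M : Matrix m m R) (k : ℕ) : (reindex e e M ^ k).trace = (M ^ k).trace := by
  rw [← coe_reindexRingEquiv, ← map_pow, coe_reindexRingEquiv, trace, trace]
  exact Fintype.sum_equiv e.symm _ _ fun i => rfl

end Matrix

theorem ZMod.sum_val_eq_sum_range {M : Type*} [AddCommMonoid M] (p : ℕ) [NeZero p] (g : ℕ → M) :
    ∑ i : ZMod p, g i.val = ∑ i ∈ Finset.range p, g i := by
  cases p with
  | zero => exact absurd rfl (NeZero.ne 0)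
  | succ p => exact Fin.sum_univ_eq_sum_range g (p + 1)

/-- A number congruent to `∑ i, f i * q ^ i` modulo `q ^ p - 1` has `f 0` as its last digit in
base `q`, provided that it is reduced and that the `f i` are smaller than `q - 1`. -/
theorem mod_eq_of_modEq_sum_mul_pow {p q x : ℕ} (hp : p ≠ 0) (hq : 2 ≤ q) {f : ℕ → ℕ}
    (hf : ∀ i, f i < q - 1) (hx : x < q ^ p - 1)
    (h : x ≡ ∑ i ∈ Finset.range p, f i * q ^ i [MOD q ^ p - 1]) : x % q = f 0 := by
  obtain ⟨p, rfl⟩ := Nat.exists_eq_succ_of_ne_zero hp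
  -- Digits below `q - 1`, not just below `q`, exclude the all-`(q - 1)` number, which is `0` modulo
  -- `q ^ (p + 1) - 1`. Hence the sum is its own residue.
  have hlt : ∑ i ∈ Finset.range (p + 1), f i * q ^ i < q ^ (p + 1) - 1 := by
    calc ∑ i ∈ Finset.range (p + 1), f i * q ^ i
        < ∑ i ∈ Finset.range (p + 1), (q - 1) * q ^ i :=
          Finset.sum_lt_sum_of_nonempty (by simp) fun i _ =>
            Nat.mul_lt_mul_of_pos_right (hf i) (by positivity)
      _ = q ^ (p + 1) - 1 := by
          rw [← Finset.mul_sum, Nat.geomSum_eq hq, Nat.mul_div_cancel' (Nat.sub_one_dvd_pow_sub_one q _)]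
  rw [Nat.ModEq, Nat.mod_eq_of_lt hx, Nat.mod_eq_of_lt hlt] at h
  rw [h, Finset.sum_range_succ', Finset.sum_congr rfl fun i _ =>
    show f (i + 1) * q ^ (i + 1) = q * (f (i + 1) * q ^ i) by ring, ← Finset.mul_sum,
    Nat.mul_add_mod, pow_zero, mul_one, Nat.mod_eq_of_lt]
  have := hf 0
  omega

/-- The sum of `g` over the positions below `p` of the binary digits `1` of `m`. -/
def maskSum (g : ℕ → ℕ) (m : ℕ) : ℕ → ℕ
  | 0 => 0
  | i + 1 => maskSum g m i + bif m.testBit i then g i else 0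

theorem maskSum_eq (g : ℕ → ℕ) (m p : ℕ) :
    maskSum g m p = ∑ i ∈ Finset.range p, g i * if m.testBit i then 1 else 0 := by
  induction p with
  | zero => simp [maskSum]
  | succ p ih =>
    rw [maskSum, ih, Finset.sum_range_succ]
    cases m.testBit p <;> simp

/-- `binomialPair` in `ℕ`, reduced modulo `N`. -/
def binomialPairMod (N a b : ℕ) : ℕ → ℕ × ℕ
  | 0 => (1, 0)
  | k + 1 => (((binomialPairMod N a b k).1 * a + (binomialPairMod N a b k).2 * b) % N,
      ((binomialPairMod N a b k).1 + (binomialPairMod N a b k).2 * a) % N)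

theorem cast_binomialPairMod (N a b k : ℕ) :
    ((binomialPairMod N a b k).1 : ZMod N) = (binomialPair (a : ZMod N) b k).1 ∧
      ((binomialPairMod N a b k).2 : ZMod N) = (binomialPair (a : ZMod N) b k).2 := by
  induction k with
  | zero => simp [binomialPair, binomialPairMod]
  | succ k ih => simp [binomialPair, binomialPairMod, ih.1, ih.2]

theorem binomialPairMod_fst_lt {N : ℕ} (hN : 1 < N) (a b k : ℕ) :
    (binomialPairMod N a b k).1 < N := by
  cases k with
  | zero => exact hN
  | succ k => exact Nat.mod_lt _ (by omega)

/-- The number of closed walks of length `k` based at `1` in the Cayley graph over the dihedral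
group given by the rotations in the bit mask `R` and the reflections in the bit mask `F`. -/
def closedWalkCount (p R F k : ℕ) : ℕ :=
  (binomialPairMod (2 ^ (64 * p) - 1) (maskSum (fun i => 2 ^ (64 * i)) R p)
    (maskSum (fun i => 2 ^ (64 * ((p - i) % p))) F p * maskSum (fun i => 2 ^ (64 * i)) F p)
    k).1 % 2 ^ 64

/-! ### Closed walks in Cayley graphs over dihedral groups -/

section Dihedral

open DihedralGroup Matrix

variable {p : ℕ}

open Classical in
/-- The circulant matrix of the rotations in `S`. -/
noncomputable def rotationMatrix (R : Type*) [Zero R] [One R] (S : Set (DihedralGroup p)) :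
    Matrix (ZMod p) (ZMod p) R :=
  circulant fun i => if r i ∈ S then 1 else 0

open Classical in
/-- The circulant matrix of the reflections in `S`. -/
noncomputable def reflectionMatrix (R : Type*) [Zero R] [One R] (S : Set (DihedralGroup p)) :
    Matrix (ZMod p) (ZMod p) R :=
  circulant fun i => if sr i ∈ S then 1 else 0

theorem reindex_adjMatrix_cayleyGraph {R : Type*} [Zero R] [One R] {S : Set (DihedralGroup p)}
    (hS : IsConnectionSet S) :
    reindex equivSum equivSum ((cayleyGraph S).adjMatrix R) =
      fromBlocks (rotationMatrix R S) (reflectionMatrix R S)ᵀ (reflectionMatrix R S)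
        (rotationMatrix R S) := by
  have hneg : ∀ i : ZMod p, r i ∈ S ↔ r (-i) ∈ S := fun i =>
    ⟨fun h => by simpa using hS.inv_mem _ h, fun h => by simpa using hS.inv_mem _ h⟩
  classical
  ext (i | i) (j | j) <;>
    simp only [reindex_apply, submatrix_apply, SimpleGraph.adjMatrix_apply,
      equivSum_symm_apply, fromBlocks_apply₁₁, fromBlocks_apply₁₂, fromBlocks_apply₂₁,
      fromBlocks_apply₂₂, rotationMatrix, reflectionMatrix, transpose_apply, circulant_apply] <;>
    refine if_congr ?_ rfl rfl <;>
    simp only [cayleyGraph_adj hS, inv_r, inv_sr, r_mul_r, r_mul_sr, sr_mul_r, sr_mul_sr,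
      ← sub_eq_add_neg]
  -- The remaining block compares two reflections: `sr i * sr j` is `r (j - i)`, whereas the
  -- circulant has `i - j`.
  rw [hneg, neg_sub]

theorem trace_adjMatrix_cayleyGraph_pow [NeZero p] {S : Set (DihedralGroup p)}
    (hS : IsConnectionSet S) {R F : ℕ} (hR : ∀ i : ZMod p, r i ∈ S ↔ R.testBit i.val)
    (hF : ∀ i : ZMod p, sr i ∈ S ↔ F.testBit i.val) {k : ℕ} (hk : (2 * p) ^ k < 2 ^ 64 - 1) :
    ((cayleyGraph S).adjMatrix ℕ ^ k).trace = 2 * p * closedWalkCount p R F k := by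
  classical
  set P := rotationMatrix ℕ S with hP
  set Q := reflectionMatrix ℕ S with hQ
  have hpow : reindex equivSum equivSum ((cayleyGraph S).adjMatrix ℕ) ^ k = _ :=
    (congrArg (· ^ k) (reindex_adjMatrix_cayleyGraph hS)).trans
      (fromBlocks_pow_of_commute (by rw [rotationMatrix, reflectionMatrix, transpose_circulant,
        circulant_mul_comm]) (by rw [rotationMatrix, reflectionMatrix, circulant_mul_comm])
        (by rw [reflectionMatrix, transpose_circulant, circulant_mul_comm]) k)
  rw [← trace_reindex_pow equivSum, hpow, trace, Fintype.sum_sum_type, ← hP, ← hQ]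
  obtain ⟨u, hu⟩ : ∃ u, (binomialPair P (Qᵀ * Q) k).1 = circulant u := by
    rw [hP, hQ, reflectionMatrix, transpose_circulant, circulant_mul, rotationMatrix]
    exact (exists_circulant_binomialPair _ _ k).1
  have hu_lt : ∀ i, u i < 2 ^ 64 - 1 := by
    intro i
    have h1 := pow_apply_le_card_pow
      (M := reindex equivSum equivSum ((cayleyGraph S).adjMatrix ℕ)) (fun x y => by
        rw [reindex_apply, submatrix_apply, SimpleGraph.adjMatrix_apply]
        split_ifs <;> simp) k (.inl i) (.inl 0)
    rw [hpow, fromBlocks_apply₁₁, ← hP, ← hQ, hu, circulant_apply, sub_zero, Fintype.card_sum,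
      ZMod.card, ← two_mul] at h1
    exact h1.trans_lt hk
  suffices closedWalkCount p R F k = u 0 by
    simp only [diag_apply, fromBlocks_apply₁₁, fromBlocks_apply₂₂, hu, circulant_apply, sub_self,
      this, Finset.sum_const, Finset.card_univ, ZMod.card, smul_eq_mul]
    ring
  -- Kronecker substitution: `2 ^ 64` is a `p`-th root of unity modulo `N`, so `e` is a character of
  -- `ZMod p`. The eigenvalue of `circulant u` at `e` is the number with digits `u i` in base `2 ^
  -- 64`, and its last digit is `u 0`.
  let N := 2 ^ (64 * p) - 1
  let e : ZMod p → ZMod N := fun i => ((2 ^ (64 * i.val) : ℕ) : ZMod N)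
  have hone : ((2 : ZMod N) ^ 64) ^ p = 1 := by
    rw [← pow_mul]
    have h : ((2 ^ (64 * p) - 1 : ℕ) : ZMod N) = 0 := ZMod.natCast_self N
    rwa [Nat.cast_sub Nat.one_le_two_pow, Nat.cast_one, sub_eq_zero, Nat.cast_pow,
      Nat.cast_ofNat] at h
  have he : ∀ i j, e (i + j) = e i * e j := by
    intro i j
    simp only [e, Nat.cast_pow, Nat.cast_ofNat, pow_mul, ZMod.val_add]
    rw [← pow_add, ← pow_eq_pow_mod _ hone]
  let φ := Nat.castRingHom (ZMod N)
  have hPe : e ᵥ* P.map φ = ((maskSum (fun i => 2 ^ (64 * i)) R p : ℕ) : ZMod N) • e := by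
    rw [hP, rotationMatrix, map_circulant, vecMul_circulant_of_map_add he, maskSum_eq,
      ← ZMod.sum_val_eq_sum_range, Nat.cast_sum]
    congr 1
    refine Finset.sum_congr rfl fun i _ => ?_
    simp [e, φ, hR]
  have hQe : e ᵥ* Q.map φ = ((maskSum (fun i => 2 ^ (64 * i)) F p : ℕ) : ZMod N) • e := by
    rw [hQ, reflectionMatrix, map_circulant, vecMul_circulant_of_map_add he, maskSum_eq,
      ← ZMod.sum_val_eq_sum_range, Nat.cast_sum]
    congr 1
    refine Finset.sum_congr rfl fun i _ => ?_
    simp [e, φ, hF]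
  have hQe' : e ᵥ* Qᵀ.map φ =
      ((maskSum (fun i => 2 ^ (64 * ((p - i) % p))) F p : ℕ) : ZMod N) • e := by
    rw [hQ, reflectionMatrix, transpose_circulant, map_circulant, vecMul_circulant_of_map_add he,
      maskSum_eq, ← ZMod.sum_val_eq_sum_range, Nat.cast_sum]
    congr 1
    refine Fintype.sum_equiv (Equiv.neg _) _ _ fun i => ?_
    rw [Equiv.neg_apply, ← ZMod.neg_val', neg_neg]
    simp [e, φ, hF]
  have hWe : e ᵥ* (Qᵀ * Q).map φ = ((maskSum (fun i => 2 ^ (64 * ((p - i) % p))) F p *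
      maskSum (fun i => 2 ^ (64 * i)) F p : ℕ) : ZMod N) • e := by
    rw [Matrix.map_mul, ← vecMul_vecMul, hQe', smul_vecMul, hQe, smul_smul, Nat.cast_mul]
  have key := congrFun (vecMul_binomialPair hPe hWe k).1 0
  rw [← (map_binomialPair φ P (Qᵀ * Q) k).1, hu, ← (cast_binomialPairMod _ _ _ k).1] at key
  have hN : 1 < N := by
    have : 2 ^ 64 ≤ 2 ^ (64 * p) := Nat.pow_le_pow_right (by norm_num)
      (Nat.le_mul_of_pos_right _ (NeZero.pos p))
    simp only [N]
    omega
  refine mod_eq_of_modEq_sum_mul_pow (f := fun i => u i) (NeZero.ne p) (by norm_num)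
    (fun i => hu_lt _) (by rw [← pow_mul]; exact binomialPairMod_fst_lt hN _ _ k) ?_ |>.trans
      (by simp)
  rw [← pow_mul, ← ZMod.natCast_eq_natCast_iff, Nat.cast_sum, ← ZMod.sum_val_eq_sum_range p
    (fun i => ((u i * (2 ^ 64) ^ i : ℕ) : ZMod (2 ^ (64 * p) - 1)))]
  simp only [vecMul, dotProduct, map_apply, circulant_apply, sub_zero, Pi.smul_apply, e,
    ZMod.val_zero, mul_zero, pow_zero, Nat.cast_one, smul_eq_mul, mul_one] at key
  rw [← key]
  refine Finset.sum_congr rfl fun i _ => ?_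
  rw [Nat.cast_mul, ← pow_mul, ZMod.natCast_zmod_val]
  exact mul_comm _ _

end Dihedral

/-! ### The finite check on bit masks up to affine maps -/

/-- The bit mask of the image under `i ↦ u * i + c` modulo `p` of the positions of the first binary
digits `1` of `m`. -/
def maskImage (p u c m : ℕ) : ℕ → ℕ
  | 0 => 0
  | i + 1 => maskImage p u c m i ||| bif m.testBit i then 1 <<< ((u * i + c) % p) else 0

theorem testBit_maskImage (p u c m n k : ℕ) :
    (maskImage p u c m n).testBit k ↔ ∃ i < n, m.testBit i ∧ (u * i + c) % p = k := by
  induction n with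
  | zero => simp [maskImage]
  | succ n ih =>
    simp only [maskImage, Nat.testBit_or, Bool.or_eq_true, ih, Nat.lt_succ_iff_lt_or_eq, or_and_right,
      exists_or, exists_eq_left]
    refine or_congr Iff.rfl ?_
    cases m.testBit n <;> simp [Nat.one_shiftLeft, Nat.testBit_two_pow]

theorem testBit_maskImage_val (p u c m : ℕ) [NeZero p] (j : ZMod p) :
    (maskImage p u c m p).testBit j.val ↔
      ∃ i : ZMod p, m.testBit i.val ∧ (u : ZMod p) * i + c = j := by
  have key : ∀ i : ℕ, (u * i + c) % p = j.val ↔ (u : ZMod p) * i + c = j := by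
    intro i
    rw [← ZMod.val_natCast, (ZMod.val_injective p).eq_iff]
    push_cast
    rfl
  rw [testBit_maskImage]
  constructor
  · rintro ⟨i, hi, hm, h⟩
    exact ⟨i, by rwa [ZMod.val_natCast, Nat.mod_eq_of_lt hi], (key i).1 h⟩
  · rintro ⟨i, hm, h⟩
    exact ⟨i.val, i.val_lt, hm, (key _).2 (by simpa using h)⟩

theorem testBit_foldr_or (l : List ℕ) (k : ℕ) :
    (l.foldr (· ||| ·) 0).testBit k ↔ ∃ m ∈ l, m.testBit k := by
  induction l with
  | nil => simp
  | cons m l ih => simp [ih]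

/-- Every subset of `ZMod p` is affinely equivalent to one with its bit mask in `L`: the bits of the
number on the left record the bit masks of the affine images of members of `L`. -/
def affinelyCovers (p : ℕ) (L : List ℕ) : Bool :=
  (L.map fun F => ((List.range (p - 1)).map fun u => ((List.range p).map fun c =>
    1 <<< maskImage p (u + 1) c F p).foldr (· ||| ·) 0).foldr (· ||| ·) 0).foldr (· ||| ·) 0 ==
    2 ^ 2 ^ p - 1

theorem exists_of_affinelyCovers {p : ℕ} {L : List ℕ} (h : affinelyCovers p L) {F : ℕ}
    (hF : F < 2 ^ p) : ∃ F₀ ∈ L, ∃ u c, 0 < u ∧ u < p ∧ maskImage p u c F₀ p = F := by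
  have h1 : (2 ^ 2 ^ p - 1).testBit F := by
    rw [Nat.testBit_two_pow_sub_one, decide_eq_true_iff]
    exact hF
  rw [← eq_of_beq h] at h1
  simp only [testBit_foldr_or, List.mem_map, List.mem_range, exists_exists_and_eq_and,
    Nat.one_shiftLeft, Nat.testBit_two_pow, decide_eq_true_iff] at h1
  obtain ⟨F₀, hF₀, u, hu, c, -, h⟩ := h1
  exact ⟨F₀, hF₀, u + 1, c, by omega, by omega, h⟩

/-- The bit mask `m` describes a subset of `ZMod p` that is closed under negation and omits `0`. -/
def isSymmMask (p m : ℕ) : Bool :=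
  !m.testBit 0 && (List.range p).all fun i => m.testBit i == m.testBit ((p - i) % p)

/-- The pairs of a bit mask of rotations and a bit mask from `L` of reflections. -/
def maskPairs (p : ℕ) (L : List ℕ) : List (ℕ × ℕ) :=
  ((List.range (2 ^ p)).filter (isSymmMask p)).flatMap fun R => L.map fun F => (R, F)

/-- Some affine permutation carries the pair `x` to the pair `y`. -/
def affineEquiv (p : ℕ) (x y : ℕ × ℕ) : Bool :=
  (List.range p).any fun u => u != 0 && (maskImage p u 0 x.1 p == y.1 &&
    (List.range p).any fun c => maskImage p u c x.2 p == y.2)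

/-- The numbers of closed walks of length at most `n`, packed into one number. -/
def closedWalkCode (p : ℕ) (x : ℕ × ℕ) : ℕ → ℕ
  | 0 => 0
  | n + 1 => closedWalkCode p x n * 2 ^ 64 + closedWalkCount p x.1 x.2 (n + 1)

/-- Pairs in `maskPairs p L` with the same numbers of closed walks of length at most `11` are
affinely equivalent. The pairs are sorted by the number of closed walks of length `2` first. -/
def closedWalksDetermine (p : ℕ) (L : List ℕ) : Bool :=
  (List.range (2 * p)).all fun k =>
    let B := (maskPairs p L).filter fun x => closedWalkCount p x.1 x.2 2 % (2 * p) == k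
    B.all fun x => B.all fun y =>
      closedWalkCode p x 11 != closedWalkCode p y 11 || (x == y || affineEquiv p x y)

theorem eq_or_affineEquiv_of_closedWalksDetermine {p : ℕ} (hp : 0 < p) {L : List ℕ}
    (h : closedWalksDetermine p L) {x y : ℕ × ℕ} (hx : x ∈ maskPairs p L) (hy : y ∈ maskPairs p L)
    (hxy : ∀ k ≤ 11, closedWalkCount p x.1 x.2 k = closedWalkCount p y.1 y.2 k) :
    x = y ∨ affineEquiv p x y := by
  -- Only this direction is needed, so it does not matter whether the packing into one number is
  -- injective.
  have hcode : ∀ n ≤ 11, closedWalkCode p x n = closedWalkCode p y n := by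
    intro n
    induction n with
    | zero => intro _; rfl
    | succ n ih =>
      intro hn
      rw [closedWalkCode, closedWalkCode, ih (by omega), hxy _ hn]
  simp only [closedWalksDetermine, List.all_eq_true, List.mem_range, List.mem_filter, beq_iff_eq,
    Bool.or_eq_true, bne_iff_ne] at h
  -- The reduction modulo `2 * p` makes the bucket index lie in the range without any bound on the
  -- count.
  refine (h _ (Nat.mod_lt (closedWalkCount p y.1 y.2 2) (by omega)) x ⟨hx, ?_⟩ y
    ⟨hy, rfl⟩).resolve_left fun h' => h' (hcode 11 le_rfl)
  rw [hxy 2 (by norm_num)]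

/-! ### From the finite check to isomorphisms -/

section Dihedral

open DihedralGroup

/-- The pair `x` consists of the bit masks of the rotations and of the reflections in `S`. -/
structure HasMasks {p : ℕ} (S : Set (DihedralGroup p)) (x : ℕ × ℕ) : Prop where
  rotation_iff : ∀ i : ZMod p, r i ∈ S ↔ x.1.testBit i.val
  reflection_iff : ∀ i : ZMod p, sr i ∈ S ↔ x.2.testBit i.val

theorem ZMod.exists_mask {p : ℕ} [NeZero p] (P : ZMod p → Prop) :
    ∃ m < 2 ^ p, ∀ i, P i ↔ m.testBit i.val := by
  classical
  refine ⟨Nat.ofBits fun i : Fin p => decide (P (i : ℕ)), Nat.ofBits_lt_two_pow _, fun i => ?_⟩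
  rw [Nat.testBit_ofBits_lt _ _ i.val_lt]
  simp

variable {p : ℕ} [Fact p.Prime]

/-- The automorphism of the dihedral group induced by an affine permutation of `ZMod p`. -/
def DihedralGroup.affineAut (u c : ZMod p) (hu : u ≠ 0) : DihedralGroup p ≃* DihedralGroup p where
  toFun
    | r i => r (u * i)
    | sr i => sr (u * i + c)
  invFun
    | r i => r (u⁻¹ * i)
    | sr i => sr (u⁻¹ * (i - c))
  left_inv := by rintro (i | i) <;> simp [hu]
  right_inv := by rintro (i | i) <;> simp [hu]
  map_mul' := by
    rintro (i | i) (j | j) <;> simp only [r_mul_r, r_mul_sr, sr_mul_r, sr_mul_sr] <;> congr 1 <;> ring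

theorem HasMasks.set_eq {p : ℕ} {S S' : Set (DihedralGroup p)} {x : ℕ × ℕ} (hS : HasMasks S x)
    (hS' : HasMasks S' x) : S = S' := by
  ext (i | i)
  · rw [hS.rotation_iff, hS'.rotation_iff]
  · rw [hS.reflection_iff, hS'.reflection_iff]

theorem nonempty_iso_of_affineEquiv {S S' : Set (DihedralGroup p)} {x y : ℕ × ℕ}
    (hS : HasMasks S x) (hS' : HasMasks S' y) (h : affineEquiv p x y) :
    Nonempty (cayleyGraph S ≃g cayleyGraph S') := by
  simp only [affineEquiv, List.any_eq_true, List.mem_range, Bool.and_eq_true, bne_iff_ne,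
    beq_iff_eq] at h
  obtain ⟨u, hup, hu, h1, c, -, h2⟩ := h
  have hu0 : (u : ZMod p) ≠ 0 := by
    rw [Ne, ZMod.natCast_eq_zero_iff]
    exact Nat.not_dvd_of_pos_of_lt (Nat.pos_of_ne_zero hu) hup
  refine ⟨cayleyGraphIsoOfMulEquiv (DihedralGroup.affineAut (u : ZMod p) c hu0) ?_⟩
  rintro (i | i)
  · change r ((u : ZMod p) * i) ∈ S' ↔ _
    rw [hS'.rotation_iff, hS.rotation_iff, ← h1, testBit_maskImage_val]
    simp [hu0]
  · change sr ((u : ZMod p) * i + (c : ZMod p)) ∈ S' ↔ _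
    rw [hS'.reflection_iff, hS.reflection_iff, ← h2, testBit_maskImage_val]
    simp [hu0]

/-- An affine map carrying a listed mask to the reflections of `S` extends to an automorphism of the
group. Pulling `S` back along it normalises the reflections, and the rotations still form a
symmetric set without `1`. -/
theorem exists_iso_mem_maskPairs {L : List ℕ} (hL : affinelyCovers p L)
    {S : Set (DihedralGroup p)} (hS : IsConnectionSet S) :
    ∃ S₁ : Set (DihedralGroup p), IsConnectionSet S₁ ∧
      Nonempty (cayleyGraph S₁ ≃g cayleyGraph S) ∧ ∃ x ∈ maskPairs p L, HasMasks S₁ x := by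
  obtain ⟨F, hF, hFS⟩ := ZMod.exists_mask fun i : ZMod p => sr i ∈ S
  obtain ⟨F₀, hF₀, u, c, hu, hup, h⟩ := exists_of_affinelyCovers hL hF
  have hu0 : (u : ZMod p) ≠ 0 := by
    rw [Ne, ZMod.natCast_eq_zero_iff]
    exact Nat.not_dvd_of_pos_of_lt hu hup
  let ψ := DihedralGroup.affineAut (u : ZMod p) c hu0
  have hS₁ : IsConnectionSet (ψ ⁻¹' S) :=
    ⟨by simpa using hS.one_notMem, fun g hg => by simpa using hS.inv_mem _ hg⟩
  obtain ⟨R, hR, hRS⟩ := ZMod.exists_mask fun i : ZMod p => r i ∈ ψ ⁻¹' S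
  refine ⟨ψ ⁻¹' S, hS₁, ⟨cayleyGraphIsoOfMulEquiv ψ fun g => Iff.rfl⟩, (R, F₀), ?_, hRS, fun i => ?_⟩
  · simp only [maskPairs, List.mem_flatMap, List.mem_filter, List.mem_range, List.mem_map,
      Prod.mk.injEq, exists_eq_right_right]
    refine ⟨⟨hR, ?_⟩, hF₀⟩
    simp only [isSymmMask, Bool.and_eq_true, Bool.not_eq_true', List.all_eq_true, List.mem_range,
      beq_iff_eq]
    constructor
    · rw [← Bool.not_eq_true, ← ZMod.val_zero (n := p), ← hRS, r_zero]
      exact hS₁.one_notMem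
    · intro i hi
      have h1 : (i : ZMod p).val = i := by rw [ZMod.val_natCast, Nat.mod_eq_of_lt hi]
      rw [Bool.eq_iff_iff, ← h1, ← ZMod.neg_val', ← hRS, ← hRS]
      exact ⟨fun h => by simpa using hS₁.inv_mem _ h, fun h => by simpa using hS₁.inv_mem _ h⟩
  · change sr ((u : ZMod p) * i + (c : ZMod p)) ∈ S ↔ _
    rw [hFS, ← h, testBit_maskImage_val]
    simp [hu0]

/-- Cospectrality enters only through the traces of the powers up to `11`. The bound on `p` ensures
that all these walk counts fit into one digit. -/
theorem Cospectral.nonempty_iso_of_masks {L : List ℕ} (hp : (2 * p) ^ 11 < 2 ^ 64 - 1)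
    (hL : affinelyCovers p L) (hdet : closedWalksDetermine p L) {S S' : Set (DihedralGroup p)}
    (hS : IsConnectionSet S) (hS' : IsConnectionSet S')
    (h : Cospectral (cayleyGraph S) (cayleyGraph S')) :
    Nonempty (cayleyGraph S ≃g cayleyGraph S') := by
  classical
  obtain ⟨S₁, hS₁, ⟨e⟩, x, hx, hxS⟩ := exists_iso_mem_maskPairs hL hS
  obtain ⟨S₂, hS₂, ⟨e'⟩, y, hy, hyS⟩ := exists_iso_mem_maskPairs hL hS'
  have hp0 := (Fact.out : p.Prime).pos
  have h12 : Cospectral (cayleyGraph S₁) (cayleyGraph S₂) :=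
    e.cospectral.trans (h.trans e'.symm.cospectral)
  have hwalk : ∀ k ≤ 11, closedWalkCount p x.1 x.2 k = closedWalkCount p y.1 y.2 k := by
    intro k hk
    have hlt : (2 * p) ^ k < 2 ^ 64 - 1 := (Nat.pow_le_pow_right (by omega) hk).trans_lt hp
    have := h12.trace_pow_eq k
    rw [trace_adjMatrix_cayleyGraph_pow hS₁ hxS.1 hxS.2 hlt,
      trace_adjMatrix_cayleyGraph_pow hS₂ hyS.1 hyS.2 hlt] at this
    exact Nat.eq_of_mul_eq_mul_left (by omega) this
  obtain ⟨e''⟩ : Nonempty (cayleyGraph S₁ ≃g cayleyGraph S₂) := by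
    rcases eq_or_affineEquiv_of_closedWalksDetermine hp0 hdet hx hy hwalk with rfl | hxy
    · rw [hxS.set_eq hyS]
      exact ⟨SimpleGraph.Iso.refl⟩
    · exact nonempty_iso_of_affineEquiv hxS hyS hxy
  exact ⟨(e.symm.trans e'').trans e'⟩

/-- To see that a dihedral group is Cay-DS it suffices to compare Cayley graphs over that group. -/
theorem isCayDS_dihedralGroup_of_forall
    (h : ∀ S S' : Set (DihedralGroup p), IsConnectionSet S → IsConnectionSet S' →
      Cospectral (cayleyGraph S) (cayleyGraph S') → Nonempty (cayleyGraph S ≃g cayleyGraph S')) :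
    IsCayDS (DihedralGroup p) := by
  intro S hS H _ _ T hT hST
  obtain ⟨S', hS', ⟨e⟩⟩ := exists_dihedral_iso (p := p)
    (by rw [← hST.card_eq, DihedralGroup.card]) hT
  obtain ⟨e'⟩ := h S S' hS hS' (hST.trans e.symm.cospectral)
  exact ⟨e'.trans e⟩

end Dihedral

/-! ### Isomorphism invariants and characteristic polynomials -/

open DihedralGroup

theorem IsConnectionSet.degree_cayleyGraph {G : Type*} [Group G] [Fintype G] {S : Set G}
    (hS : IsConnectionSet S) (x : G) [Fintype ((cayleyGraph S).neighborSet x)] :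
    (cayleyGraph S).degree x = S.ncard := by
  rw [← SimpleGraph.card_neighborSet_eq_degree, ← Nat.card_eq_fintype_card, Nat.card_coe_set_eq]
  refine Set.ncard_congr (fun y _ => y * x⁻¹) (fun y hy => ?_) (fun y z _ _ => by simp)
    fun a ha => ⟨a * x, ?_, by simp⟩
  · rwa [SimpleGraph.mem_neighborSet, SimpleGraph.adj_comm, cayleyGraph_adj hS] at hy
  · rw [SimpleGraph.mem_neighborSet, SimpleGraph.adj_comm, cayleyGraph_adj hS]
    simpa using ha

/-- By right translations an isomorphism may be assumed to fix `1`, and then it maps `S`, the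
neighbourhood of `1`, onto `T`. Colouring pairs of neighbours by an isomorphism-invariant function,
it preserves the number of pairs of colour `m` at each neighbour. -/
theorem IsConnectionSet.isEmpty_iso {G H : Type*} [Group G] [Group H] [Finite G] [Finite H]
    {S : Set G} {T : Set H} (hS : IsConnectionSet S) (hT : IsConnectionSet T) {f : G → G → ℕ}
    {g : H → H → ℕ} (hfg : ∀ (e : cayleyGraph S ≃g cayleyGraph T) (x y), g (e x) (e y) = f x y)
    (m d : ℕ) (h₁ : ∃ y ∈ S, {z ∈ S | z ≠ y ∧ f y z = m}.ncard = d)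
    (h₂ : ∀ y ∈ T, {z ∈ T | z ≠ y ∧ g y z = m}.ncard ≠ d) :
    IsEmpty (cayleyGraph S ≃g cayleyGraph T) := by
  refine ⟨fun e₀ => ?_⟩
  let e := e₀.trans (cayleyGraphRightMul T (e₀ 1)⁻¹)
  have he1 : e 1 = 1 := mul_inv_cancel (e₀ 1)
  have hmem : ∀ x, e x ∈ T ↔ x ∈ S := by
    intro x
    have := e.map_rel_iff (a := x) (b := 1)
    rwa [he1, cayleyGraph_adj hS, cayleyGraph_adj hT, inv_one, inv_one, mul_one, mul_one] at this
  obtain ⟨y, hy, hyd⟩ := h₁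
  refine h₂ (e y) ((hmem y).2 hy) ?_
  rw [← hyd, ← Set.ncard_image_of_injective _ e.injective]
  congr 1
  ext z
  obtain ⟨z, rfl⟩ := e.surjective z
  rw [e.injective.mem_set_image]
  simp [hmem, hfg]

theorem SimpleGraph.Iso.ncard_commonNeighbors {V W : Type*} {Γ : SimpleGraph V}
    {Γ' : SimpleGraph W} (e : Γ ≃g Γ') (x y : V) :
    (Γ'.commonNeighbors (e x) (e y)).ncard = (Γ.commonNeighbors x y).ncard := by
  rw [← Set.ncard_image_of_injective _ e.injective]
  congr 1
  ext z
  obtain ⟨z, rfl⟩ := e.surjective z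
  rw [e.injective.mem_set_image]
  exact and_congr e.map_rel_iff e.map_rel_iff

/-- Multiplying the characteristic matrix on the right by the block matrix with rows `(1, B)` and
`(0, X)` makes it block lower triangular, with diagonal blocks `X` and `X ^ 2 - C * B`. Thus only `C
* B` matters once a power of `X` is cancelled. -/
theorem Matrix.charpoly_fromBlocks_zero_eq {n R : Type*} [Fintype n] [DecidableEq n] [CommRing R]
    [IsDomain R] {B C B' C' : Matrix n n R} (h : C * B = C' * B') :
    (fromBlocks 0 B C 0).charpoly = (fromBlocks 0 B' C' 0).charpoly := by
  have key : ∀ B C : Matrix n n R, (fromBlocks 0 B C 0).charpoly * Polynomial.X ^ Fintype.card n =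
      Polynomial.X ^ Fintype.card n *
        (scalar n (Polynomial.X ^ 2) - (C * B).map Polynomial.C).det := by
    intro B C
    have h1 : (scalar n (Polynomial.X : Polynomial R)).det = Polynomial.X ^ Fintype.card n := by
      simp
    have h2 : (fromBlocks 1 (B.map Polynomial.C) 0 (scalar n (Polynomial.X : Polynomial R))).det =
        Polynomial.X ^ Fintype.card n := by
      rw [det_fromBlocks_zero₂₁, det_one, one_mul, h1]
    rw [charpoly, charmatrix_fromBlocks, ← h2, ← det_mul, fromBlocks_multiply, h2, ← h1,
      ← det_fromBlocks_zero₁₂ _ (-C.map Polynomial.C)]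
    congr 1
    simp only [charmatrix, Matrix.map_mul, scalar_apply]
    congr 1
    · simp
    · simp [← smul_one_eq_diagonal]
    · simp
    · simp [← smul_one_eq_diagonal, pow_two, smul_smul, sub_eq_neg_add]
  have hX : (Polynomial.X : Polynomial R) ^ Fintype.card n ≠ 0 := pow_ne_zero _ Polynomial.X_ne_zero
  refine mul_right_cancel₀ hX ?_
  rw [key, key, h]

/-! ### Cayley graphs given by reflections -/

/-- The reflections with indices in `E`. -/
def reflectionSet (p : ℕ) (E : Finset ℕ) : Set (DihedralGroup p) :=
  (fun k : ℕ => (sr (k : ZMod p) : DihedralGroup p)) '' E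

/-- The number of pairs in `E` with difference congruent to `i - j` modulo `p`. -/
def differenceCount (p : ℕ) (E : Finset ℕ) (i j : ℕ) : ℕ :=
  ((E ×ˢ E).filter fun x => (p : ℤ) ∣ (i - j : ℤ) - (x.1 - x.2)).card

/-- Two differences of numbers up to `n` are at most `2 * n` apart, so modulo a larger number they
agree only if they agree in `ℤ`. This reduces all large `p` to a single modulus. -/
theorem differenceCount_eq_of_two_mul_lt {p q n : ℕ} {E : Finset ℕ} (hE : ∀ k ∈ E, k ≤ n)
    (hp : 2 * n < p) (hq : 2 * n < q) {i j : ℕ} (hi : i ∈ E) (hj : j ∈ E) :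
    differenceCount p E i j = differenceCount q E i j := by
  have key : ∀ m : ℕ, 2 * n < m → ∀ x ∈ E ×ˢ E,
      ((m : ℤ) ∣ (i - j : ℤ) - (x.1 - x.2) ↔ (i - j : ℤ) - (x.1 - x.2) = 0) := by
    intro m hm x hx
    have h1 := hE _ (Finset.mem_product.1 hx).1
    have h2 := hE _ (Finset.mem_product.1 hx).2
    have h3 := hE i hi
    have h4 := hE j hj
    refine ⟨fun h => Int.eq_zero_of_abs_lt_dvd h ?_, fun h => h ▸ dvd_zero _⟩
    rw [abs_lt]
    omega
  rw [differenceCount, differenceCount]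
  congr 1
  exact Finset.filter_congr fun x hx => (key p hp x hx).trans (key q hq x hx).symm

section ReflectionSet

variable {p : ℕ} {E : Finset ℕ}

theorem r_notMem_reflectionSet (i : ZMod p) : r i ∉ reflectionSet p E := by
  rintro ⟨k, -, h⟩
  cases h

theorem sr_mem_reflectionSet {i : ZMod p} : sr i ∈ reflectionSet p E ↔ ∃ k ∈ E, (k : ZMod p) = i := by
  simp [reflectionSet]

theorem isConnectionSet_reflectionSet : IsConnectionSet (reflectionSet p E) := by
  refine ⟨r_notMem_reflectionSet 0, ?_⟩
  rintro _ ⟨k, hk, rfl⟩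
  exact ⟨k, hk, rfl⟩

theorem natCast_injOn_of_lt (hE : ∀ k ∈ E, k < p) : Set.InjOn (Nat.cast : ℕ → ZMod p) E := by
  intro i hi j hj h
  rw [ZMod.natCast_eq_natCast_iff] at h
  exact h.eq_of_lt_of_lt (hE i hi) (hE j hj)

theorem sr_natCast_injOn_of_lt (hE : ∀ k ∈ E, k < p) :
    Set.InjOn (fun k : ℕ => (sr (k : ZMod p) : DihedralGroup p)) E := fun i hi j hj h =>
  natCast_injOn_of_lt hE hi hj (by simpa using h)

theorem ncard_reflectionSet (hE : ∀ k ∈ E, k < p) : (reflectionSet p E).ncard = E.card := by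
  rw [reflectionSet, Set.InjOn.ncard_image (sr_natCast_injOn_of_lt hE), Set.ncard_coe_finset]

/-- A common neighbour is a rotation `r l` with `l = i - s = j - t` for some `s`, `t` in `E`, and
such pairs `(s, t)` are those with `s - t = i - j` modulo `p`. -/
theorem ncard_commonNeighbors_sr (hE : ∀ k ∈ E, k < p) (i j : ℕ) :
    ((cayleyGraph (reflectionSet p E)).commonNeighbors (sr (i : ZMod p)) (sr (j : ZMod p))).ncard =
      differenceCount p E i j := by
  rw [differenceCount, ← Set.ncard_coe_finset]
  have hdvd : ∀ x : ℕ × ℕ, (p : ℤ) ∣ (i - j : ℤ) - (x.1 - x.2) ↔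
      (i : ZMod p) - x.1 = j - x.2 := by
    intro x
    rw [← ZMod.intCast_zmod_eq_zero_iff_dvd, ← sub_eq_zero (a := (i : ZMod p) - x.1)]
    push_cast
    rw [show (i : ZMod p) - j - (x.1 - x.2) = i - x.1 - (j - x.2) by ring]
  symm
  refine Set.ncard_congr (fun x _ => r ((i : ZMod p) - x.1)) ?_ ?_ ?_
  · rintro ⟨s, t⟩ hst
    simp only [Finset.coe_filter, Finset.mem_product, Set.mem_ofPred_eq, hdvd] at hst
    simp only [SimpleGraph.mem_commonNeighbors, cayleyGraph_adj isConnectionSet_reflectionSet,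
      inv_r, sr_mul_r, sr_mem_reflectionSet]
    exact ⟨⟨s, hst.1.1, by ring⟩, t, hst.1.2, by rw [hst.2]; ring⟩
  · rintro ⟨s, t⟩ ⟨s', t'⟩ hst hst' h
    simp only [Finset.coe_filter, Finset.mem_product, Set.mem_ofPred_eq, hdvd] at hst hst'
    have h1 : (i : ZMod p) - s = i - s' := by simpa using h
    have h2 : (j : ZMod p) - t = j - t' := by rw [← hst.2, ← hst'.2, h1]
    rw [natCast_injOn_of_lt hE hst.1.1 hst'.1.1 (sub_right_injective h1),
      natCast_injOn_of_lt hE hst.1.2 hst'.1.2 (sub_right_injective h2)]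
  · rintro (l | l) hl
    · simp only [SimpleGraph.mem_commonNeighbors, cayleyGraph_adj isConnectionSet_reflectionSet,
        inv_r, sr_mul_r, sr_mem_reflectionSet] at hl
      obtain ⟨⟨s, hs, hs'⟩, t, ht, ht'⟩ := hl
      refine ⟨(s, t), ?_, ?_⟩
      · simp only [Finset.coe_filter, Finset.mem_product, Set.mem_ofPred_eq, hdvd]
        exact ⟨⟨hs, ht⟩, by rw [hs', ht']; ring⟩
      · simp [hs']
    · rw [SimpleGraph.mem_commonNeighbors, cayleyGraph_adj isConnectionSet_reflectionSet, inv_sr,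
        sr_mul_sr] at hl
      exact absurd hl.1 (r_notMem_reflectionSet _)

theorem commonNeighbors_sr_r (i l : ZMod p) :
    (cayleyGraph (reflectionSet p E)).commonNeighbors (sr i) (r l) = ∅ := by
  ext (k | k) <;>
    simp [SimpleGraph.mem_commonNeighbors, cayleyGraph_adj isConnectionSet_reflectionSet,
      r_notMem_reflectionSet]

theorem isEmpty_iso_reflectionSet {E' : Finset ℕ} [NeZero p] (hE : ∀ k ∈ E, k < p)
    (hE' : ∀ k ∈ E', k < p) {f g : DihedralGroup p → DihedralGroup p → ℕ}
    (hfg : ∀ (e : cayleyGraph (reflectionSet p E) ≃g cayleyGraph (reflectionSet p E')) (x y),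
      g (e x) (e y) = f x y) {F G : ℕ → ℕ → ℕ}
    (hF : ∀ i ∈ E, ∀ j ∈ E, f (sr (i : ZMod p)) (sr (j : ZMod p)) = F i j)
    (hG : ∀ i ∈ E', ∀ j ∈ E', g (sr (i : ZMod p)) (sr (j : ZMod p)) = G i j) (m d : ℕ)
    (h₁ : ∃ i ∈ E, (E.filter fun j => j ≠ i ∧ F i j = m).card = d)
    (h₂ : ∀ i ∈ E', (E'.filter fun j => j ≠ i ∧ G i j = m).card ≠ d) :
    IsEmpty (cayleyGraph (reflectionSet p E) ≃g cayleyGraph (reflectionSet p E')) := by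
  have key : ∀ {E : Finset ℕ} {f : DihedralGroup p → DihedralGroup p → ℕ} {F : ℕ → ℕ → ℕ}
      (_ : ∀ k ∈ E, k < p)
      (_ : ∀ i ∈ E, ∀ j ∈ E, f (sr (i : ZMod p)) (sr (j : ZMod p)) = F i j), ∀ i ∈ E,
      {z ∈ reflectionSet p E | z ≠ sr (i : ZMod p) ∧ f (sr (i : ZMod p)) z = m}.ncard =
        (E.filter fun j => j ≠ i ∧ F i j = m).card := by
    intro E f F hE hF i hi
    have hinj := sr_natCast_injOn_of_lt hE
    rw [← Set.ncard_coe_finset, ← Set.InjOn.ncard_image (hinj.mono (Finset.filter_subset _ E))]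
    congr 1
    ext z
    constructor
    · rintro ⟨⟨j, hj, rfl⟩, hne, hm⟩
      refine ⟨j, ?_, rfl⟩
      rw [Finset.mem_coe, Finset.mem_filter]
      exact ⟨hj, fun h => hne (by rw [h]), by rw [← hF i hi j hj]; exact hm⟩
    · rintro ⟨j, hj, rfl⟩
      rw [Finset.mem_coe, Finset.mem_filter] at hj
      exact ⟨⟨j, hj.1, rfl⟩, fun h => hj.2.1 (hinj hj.1 hi h), by
        rw [← hj.2.2]; exact hF i hi j hj.1⟩
  refine isConnectionSet_reflectionSet.isEmpty_iso isConnectionSet_reflectionSet hfg m d ?_ ?_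
  · obtain ⟨i, hi, h⟩ := h₁
    exact ⟨_, ⟨i, hi, rfl⟩, (key hE hF i hi).trans h⟩
  · rintro _ ⟨i, hi, rfl⟩ h
    exact h₂ i hi ((key hE' hG i hi).symm.trans h)

theorem isEmpty_iso_of_differenceCount {E' : Finset ℕ} [NeZero p] (hE : ∀ k ∈ E, k < p)
    (hE' : ∀ k ∈ E', k < p) (m d : ℕ)
    (h₁ : ∃ i ∈ E, (E.filter fun j => j ≠ i ∧ differenceCount p E i j = m).card = d)
    (h₂ : ∀ i ∈ E', (E'.filter fun j => j ≠ i ∧ differenceCount p E' i j = m).card ≠ d) :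
    IsEmpty (cayleyGraph (reflectionSet p E) ≃g cayleyGraph (reflectionSet p E')) :=
  isEmpty_iso_reflectionSet hE hE' (f := fun x y => (SimpleGraph.commonNeighbors _ x y).ncard)
    (g := fun x y => (SimpleGraph.commonNeighbors _ x y).ncard) (fun e => e.ncard_commonNeighbors)
    (fun i _ j _ => ncard_commonNeighbors_sr hE i j)
    (fun i _ j _ => ncard_commonNeighbors_sr hE' i j) m d h₁ h₂

/-- Only reflections `u` contribute: the graph is bipartite, so a rotation and a reflection have no
common neighbour. -/
theorem ncard_setOf_ncard_commonNeighbors_eq_one [NeZero p] (hE : ∀ k ∈ E, k < p) (i j : ℕ) :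
    {u | ((cayleyGraph (reflectionSet p E)).commonNeighbors (sr (i : ZMod p)) u).ncard = 1 ∧
      ((cayleyGraph (reflectionSet p E)).commonNeighbors u (sr (j : ZMod p))).ncard = 1}.ncard =
    ((Finset.range p).filter fun l =>
      differenceCount p E i l = 1 ∧ differenceCount p E l j = 1).card := by
  have hrange : ∀ k ∈ Finset.range p, k < p := fun k => Finset.mem_range.1
  have hinj := sr_natCast_injOn_of_lt hrange
  rw [← Set.ncard_coe_finset, ← Set.InjOn.ncard_image (hinj.mono (Finset.filter_subset _ _))]
  congr 1
  ext u
  constructor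
  · rintro ⟨h1, h2⟩
    rcases u with u | u
    · rw [commonNeighbors_sr_r, Set.ncard_empty] at h1
      exact absurd h1 zero_ne_one
    · obtain ⟨l, hl, rfl⟩ : ∃ l < p, (l : ZMod p) = u := ⟨u.val, u.val_lt, by simp⟩
      rw [ncard_commonNeighbors_sr hE] at h1 h2
      exact ⟨l, by simp [hl, h1, h2], rfl⟩
  · rintro ⟨l, hl, rfl⟩
    rw [Finset.mem_coe, Finset.mem_filter] at hl
    exact ⟨(ncard_commonNeighbors_sr hE i l).trans hl.2.1,
      (ncard_commonNeighbors_sr hE l j).trans hl.2.2⟩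

/-- A second-order invariant of a pair of vertices: the number of vertices having exactly one common
neighbour with each of the two. It serves for `p = 19`. -/
theorem isEmpty_iso_of_card_differenceCount_eq_one {E' : Finset ℕ} [NeZero p]
    (hE : ∀ k ∈ E, k < p) (hE' : ∀ k ∈ E', k < p) (m d : ℕ)
    (h₁ : ∃ i ∈ E, (E.filter fun j => j ≠ i ∧ ((Finset.range p).filter fun l =>
      differenceCount p E i l = 1 ∧ differenceCount p E l j = 1).card = m).card = d)
    (h₂ : ∀ i ∈ E', (E'.filter fun j => j ≠ i ∧ ((Finset.range p).filter fun l =>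
      differenceCount p E' i l = 1 ∧ differenceCount p E' l j = 1).card = m).card ≠ d) :
    IsEmpty (cayleyGraph (reflectionSet p E) ≃g cayleyGraph (reflectionSet p E')) := by
  refine isEmpty_iso_reflectionSet hE hE'
    (f := fun x y => {u | (SimpleGraph.commonNeighbors _ x u).ncard = 1 ∧
      (SimpleGraph.commonNeighbors _ u y).ncard = 1}.ncard)
    (g := fun x y => {u | (SimpleGraph.commonNeighbors _ x u).ncard = 1 ∧
      (SimpleGraph.commonNeighbors _ u y).ncard = 1}.ncard) (fun e x y => ?_)
    (fun i _ j _ => ncard_setOf_ncard_commonNeighbors_eq_one hE i j)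
    (fun i _ j _ => ncard_setOf_ncard_commonNeighbors_eq_one hE' i j) m d h₁ h₂
  refine Eq.trans ?_ (Set.ncard_image_of_injective _ e.injective)
  congr 1
  ext z
  obtain ⟨z, rfl⟩ := e.surjective z
  rw [e.injective.mem_set_image]
  simp only [Set.mem_ofPred_eq, e.ncard_commonNeighbors]

theorem reflectionMatrix_reflectionSet (hE : ∀ k ∈ E, k < p) (i j : ZMod p) :
    reflectionMatrix ℝ (reflectionSet p E) i j = ∑ s ∈ E, if i - j = s then 1 else 0 := by
  classical
  rw [reflectionMatrix, Matrix.circulant_apply]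
  simp only [sr_mem_reflectionSet]
  split_ifs with h
  · obtain ⟨k, hk, h⟩ := h
    rw [Finset.sum_eq_single_of_mem k hk fun l hl hlk =>
      if_neg fun hl' => hlk (natCast_injOn_of_lt hE hl hk (hl'.symm.trans h.symm)), if_pos h.symm]
  · exact (Finset.sum_eq_zero fun k hk => if_neg fun hk' => h ⟨k, hk, hk'.symm⟩).symm

/-- Without rotations the diagonal blocks vanish and the spectrum is determined by `Q * Qᵀ` for the
reflection matrix `Q`. Its entry at `(i, j)` is the number of pairs in `E` with difference `i - j`
modulo `p`. -/
theorem cospectral_reflectionSet [NeZero p] {E' : Finset ℕ} (hE : ∀ k ∈ E, k < p)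
    (hE' : ∀ k ∈ E', k < p)
    (h : (E ×ˢ E).val.map (fun x => (x.1 - x.2 : ℤ)) = (E' ×ˢ E').val.map fun x => (x.1 - x.2 : ℤ)) :
    Cospectral (cayleyGraph (reflectionSet p E)) (cayleyGraph (reflectionSet p E')) := by
  classical
  have hrot : ∀ E : Finset ℕ, rotationMatrix ℝ (reflectionSet p E) = 0 := fun E => by
    ext i j
    simp [rotationMatrix, r_notMem_reflectionSet]
  have hmul : ∀ {E : Finset ℕ} (_ : ∀ k ∈ E, k < p) (i j : ZMod p),
      (reflectionMatrix ℝ (reflectionSet p E) * (reflectionMatrix ℝ (reflectionSet p E)).transpose)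
        i j = (((E ×ˢ E).val.map fun x => (x.1 - x.2 : ℤ)).map fun d : ℤ =>
          if i - j = (d : ZMod p) then (1 : ℝ) else 0).sum := by
    intro E hE i j
    rw [Multiset.map_map, ← Finset.sum_eq_multiset_sum, Finset.sum_product, Matrix.mul_apply]
    simp only [Matrix.transpose_apply, reflectionMatrix_reflectionSet hE, Finset.sum_mul_sum]
    rw [Finset.sum_comm]
    refine Finset.sum_congr rfl fun s _ => ?_
    rw [Finset.sum_comm]
    refine Finset.sum_congr rfl fun t _ => ?_
    -- For fixed `s` and `t`, the first indicator forces the summation index to be `i - s`.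
    rw [Finset.sum_eq_single_of_mem (i - (s : ZMod p)) (Finset.mem_univ _)]
    · rw [if_pos (by ring), one_mul]
      refine if_congr ?_ rfl rfl
      push_cast
      constructor <;> intro h <;> linear_combination -h
    · intro l _ hl
      rw [if_neg fun h' => hl (by rw [← h']; ring), zero_mul]
  rw [Cospectral, SimpleGraph.adjSpectrum_eq, SimpleGraph.adjSpectrum_eq,
    ← Matrix.charpoly_reindex equivSum ((cayleyGraph (reflectionSet p E)).adjMatrix ℝ),
    ← Matrix.charpoly_reindex equivSum ((cayleyGraph (reflectionSet p E')).adjMatrix ℝ),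
    reindex_adjMatrix_cayleyGraph isConnectionSet_reflectionSet,
    reindex_adjMatrix_cayleyGraph isConnectionSet_reflectionSet, hrot, hrot,
    Matrix.charpoly_fromBlocks_zero_eq]
  ext i j
  rw [hmul hE, hmul hE', h]

end ReflectionSet

/-! ### The primes up to `11` -/

/-- Every permutation of the Klein four-group fixing `1` is an automorphism, so the size of the
connection set determines the graph, and the trace of the squared adjacency matrix gives the size.
Subsets of equal size among three elements differ by at most one transposition. -/
theorem isCayDS_dihedralGroup_two : IsCayDS (DihedralGroup 2) := by
  classical
  refine isCayDS_dihedralGroup_of_forall fun S S' hS hS' h => ?_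
  have hswap : ∀ A B : Finset (DihedralGroup 2), 1 ∉ A → 1 ∉ B → A.card = B.card →
      ∃ x y : DihedralGroup 2, Equiv.swap x y 1 = 1 ∧ ∀ g, Equiv.swap x y g ∈ B ↔ g ∈ A := by
    decide +kernel
  have htrace : ∀ A : Set (DihedralGroup 2), IsConnectionSet A →
      ((cayleyGraph A).adjMatrix ℕ ^ 2).trace = 4 * A.toFinset.card := by
    intro A hA
    rw [pow_two, Matrix.trace]
    simp only [Matrix.diag_apply, SimpleGraph.adjMatrix_mul_self_apply_self, hA.degree_cayleyGraph,
      Set.ncard_eq_toFinset_card']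
    simp
  have hcard := h.trace_pow_eq 2
  rw [htrace S hS, htrace S' hS'] at hcard
  obtain ⟨x, y, h1, hxy⟩ := hswap S.toFinset S'.toFinset (by simpa using hS.one_notMem)
    (by simpa using hS'.one_notMem) (by omega)
  simp only [Set.mem_toFinset] at hxy
  exact ⟨cayleyGraphIsoOfMulEquiv
    (IsKleinFour.mulEquiv' (Equiv.swap x y) h1 IsKleinFour.exponent_two) hxy⟩

theorem isCayDS_dihedralGroup_three : IsCayDS (DihedralGroup 3) :=
  isCayDS_dihedralGroup_of_forall fun _ _ hS hS' h =>
    -- Here and for `5`, `7`, `11`, the list has one bit mask for each orbit of affine maps on the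
    -- subsets of `ZMod p`.
    h.nonempty_iso_of_masks (L := [0, 1, 3, 7]) (by norm_num) (by decide +kernel)
      (by decide +kernel) hS hS'

theorem isCayDS_dihedralGroup_five [Fact (Nat.Prime 5)] : IsCayDS (DihedralGroup 5) :=
  isCayDS_dihedralGroup_of_forall fun _ _ hS hS' h =>
    h.nonempty_iso_of_masks (L := [0, 1, 3, 7, 15, 31]) (by norm_num) (by decide +kernel)
      (by decide +kernel) hS hS'

theorem isCayDS_dihedralGroup_seven [Fact (Nat.Prime 7)] : IsCayDS (DihedralGroup 7) :=
  isCayDS_dihedralGroup_of_forall fun _ _ hS hS' h =>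
    h.nonempty_iso_of_masks (L := [0, 1, 3, 7, 11, 15, 23, 31, 63, 127]) (by norm_num)
      (by decide +kernel) (by decide +kernel) hS hS'

theorem isCayDS_dihedralGroup_eleven [Fact (Nat.Prime 11)] : IsCayDS (DihedralGroup 11) :=
  isCayDS_dihedralGroup_of_forall fun _ _ hS hS' h =>
    h.nonempty_iso_of_masks (L := [0, 1, 3, 7, 11, 15, 23, 27, 31, 39, 47, 55, 63, 79, 93, 95, 111,
        119, 127, 151, 159, 183, 191, 223, 255, 319, 383, 511, 1023, 2047]) (by norm_num)
      (by decide +kernel) (by decide +kernel) hS hS'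

/-! ### The homometric pair for `p ≥ 13` -/

theorem isEmpty_iso_six_reflections {p : ℕ} [hp : Fact p.Prime] (h13 : 13 ≤ p) :
    IsEmpty (cayleyGraph (reflectionSet p {0, 1, 2, 6, 8, 11}) ≃g
      cayleyGraph (reflectionSet p {0, 2, 4, 5, 10, 11})) := by
  have hE : ∀ k ∈ ({0, 1, 2, 6, 8, 11} : Finset ℕ), k ≤ 11 := by decide
  have hE' : ∀ k ∈ ({0, 2, 4, 5, 10, 11} : Finset ℕ), k ≤ 11 := by decide
  have hEp : ∀ k ∈ ({0, 1, 2, 6, 8, 11} : Finset ℕ), k < p := fun k hk =>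
    (hE k hk).trans_lt (by omega)
  have hEp' : ∀ k ∈ ({0, 2, 4, 5, 10, 11} : Finset ℕ), k < p := fun k hk =>
    (hE' k hk).trans_lt (by omega)
  -- The threshold is `2 * 11 < 23`: from there on differences do not wrap around. The primes `13`,
  -- `17`, `19` need invariants of their own.
  rcases lt_or_ge p 23 with h23 | h23
  · have hprime := hp.out
    have hcases : p = 13 ∨ p = 17 ∨ p = 19 := by
      interval_cases p <;> first | omega | exact absurd hprime (by norm_num)
    rcases hcases with rfl | rfl | rfl
    · exact isEmpty_iso_of_differenceCount hEp hEp' 3 2 (by decide +kernel) (by decide +kernel)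
    · exact isEmpty_iso_of_differenceCount hEp hEp' 2 5 (by decide +kernel) (by decide +kernel)
    · exact isEmpty_iso_of_card_differenceCount_eq_one hEp hEp' 2 1 (by decide +kernel)
        (by decide +kernel)
  · have key : ∀ {E : Finset ℕ} (_ : ∀ k ∈ E, k ≤ 11), ∀ i ∈ E,
        (E.filter fun j => j ≠ i ∧ differenceCount p E i j = 2).card =
          (E.filter fun j => j ≠ i ∧ differenceCount 23 E i j = 2).card := by
      intro E hE i hi
      congr 1
      refine Finset.filter_congr fun j hj => ?_
      rw [differenceCount_eq_of_two_mul_lt (q := 23) hE (by omega) (by norm_num) hi hj]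
    -- Join two indices when their difference occurs exactly twice. In the first set `11` is then a
    -- leaf, attached to `6`; in the second set there is no leaf.
    refine isEmpty_iso_of_differenceCount hEp hEp' 2 1 ?_ ?_
    · obtain ⟨i, hi, h⟩ : ∃ i ∈ ({0, 1, 2, 6, 8, 11} : Finset ℕ),
          (({0, 1, 2, 6, 8, 11} : Finset ℕ).filter fun j =>
            j ≠ i ∧ differenceCount 23 {0, 1, 2, 6, 8, 11} i j = 2).card = 1 := by
        decide +kernel
      exact ⟨i, hi, (key hE i hi).trans h⟩
    · intro i hi
      rw [key hE' i hi]
      revert i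
      decide +kernel

theorem cospectral_six_reflections {p : ℕ} [NeZero p] (h13 : 13 ≤ p) :
    Cospectral (cayleyGraph (reflectionSet p {0, 1, 2, 6, 8, 11}))
      (cayleyGraph (reflectionSet p {0, 2, 4, 5, 10, 11})) := by
  have hE : ∀ k ∈ ({0, 1, 2, 6, 8, 11} : Finset ℕ), k < 13 := by decide
  have hE' : ∀ k ∈ ({0, 2, 4, 5, 10, 11} : Finset ℕ), k < 13 := by decide
  exact cospectral_reflectionSet (fun k hk => (hE k hk).trans_le h13)
    (fun k hk => (hE' k hk).trans_le h13) (by decide +kernel)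

/-- For odd `p` the order forces `a = sr i` and `b = r j` with `j ≠ 0`, so `k ↦ j * k + i` gives the
automorphism. It transports the result from the standard reflections to arbitrary generators. -/
theorem exists_affineAut_of_orderOf {p : ℕ} [hp : Fact p.Prime] (hp2 : p ≠ 2) {a b : DihedralGroup p}
    (ha : orderOf a = 2) (hb : orderOf b = p) :
    ∃ ψ : DihedralGroup p ≃* DihedralGroup p, ∀ k : ℕ, ψ (sr (k : ZMod p)) = a * b ^ k := by
  rcases b with j | j
  · rcases a with i | i
    · have h1 : orderOf (r i) ∣ p := by
        rw [orderOf_dvd_iff_pow_eq_one, r_pow, CharP.cast_eq_zero, mul_zero, r_zero]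
      rw [ha, (Nat.prime_dvd_prime_iff_eq Nat.prime_two hp.out)] at h1
      exact absurd h1.symm hp2
    · have hj : j ≠ 0 := by
        rintro rfl
        rw [r_zero, orderOf_one] at hb
        exact hp.out.one_lt.ne hb
      refine ⟨DihedralGroup.affineAut j i hj, fun k => ?_⟩
      rw [r_pow, sr_mul_r, add_comm]
      rfl
  · rw [orderOf_sr] at hb
    exact absurd hb.symm hp2

theorem theorem1p2 (p : ℕ) [Fact p.Prime] :
    (IsCayDS (DihedralGroup p) ↔ p ∈ ({2, 3, 5, 7, 11} : Set ℕ)) ∧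
    (13 ≤ p → ∀ a b : DihedralGroup p, orderOf a = 2 → orderOf b = p →
      ∀ S T : Set (DihedralGroup p),
        S = {a, a * b, a * b ^ 2, a * b ^ 6, a * b ^ 8, a * b ^ 11} →
        T = {a, a * b ^ 2, a * b ^ 4, a * b ^ 5, a * b ^ 10, a * b ^ 11} →
        (∀ g ∈ S ∪ T, ∃ i : ZMod p, g = DihedralGroup.sr i) ∧
        IsConnectionSet S ∧ IsConnectionSet T ∧
        (cayleyGraph S).IsRegularOfDegree 6 ∧
        (cayleyGraph T).IsRegularOfDegree 6 ∧
        Cospectral (cayleyGraph S) (cayleyGraph T) ∧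
        IsEmpty (cayleyGraph S ≃g cayleyGraph T)) := by
  have hp : p.Prime := Fact.out
  refine ⟨⟨fun h => ?_, fun h => ?_⟩, ?_⟩
  · by_contra hmem
    have h13 : 13 ≤ p := by
      by_contra! hlt
      simp only [Set.mem_insert_iff, Set.mem_singleton_iff, not_or] at hmem
      interval_cases p <;> first | omega | exact absurd hp (by norm_num)
    obtain ⟨e⟩ := h _ isConnectionSet_reflectionSet _ _ isConnectionSet_reflectionSet
      (cospectral_six_reflections h13)
    exact (isEmpty_iso_six_reflections h13).false e
  · rcases h with rfl | rfl | rfl | rfl | rfl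
    exacts [isCayDS_dihedralGroup_two, isCayDS_dihedralGroup_three, isCayDS_dihedralGroup_five,
      isCayDS_dihedralGroup_seven, isCayDS_dihedralGroup_eleven]
  · rintro h13 a b ha hb S T hS hT
    obtain ⟨ψ, hψ⟩ := exists_affineAut_of_orderOf (by omega) ha hb
    have hSψ : S = ψ '' reflectionSet p {0, 1, 2, 6, 8, 11} := by
      rw [hS, reflectionSet, Set.image_image]
      simp only [hψ, Finset.coe_insert, Finset.coe_singleton, Set.image_insert_eq,
        Set.image_singleton, pow_zero, pow_one, mul_one]
    have hTψ : T = ψ '' reflectionSet p {0, 2, 4, 5, 10, 11} := by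
      rw [hT, reflectionSet, Set.image_image]
      simp only [hψ, Finset.coe_insert, Finset.coe_singleton, Set.image_insert_eq,
        Set.image_singleton, pow_zero, mul_one]
    have hrefl : ∀ E : Finset ℕ, ∀ g ∈ ψ '' reflectionSet p E, ∃ i : ZMod p, g = sr i := by
      rintro E _ ⟨_, ⟨k, -, rfl⟩, rfl⟩
      rcases hg : ψ (sr (k : ZMod p)) with i | i
      · have h1 : orderOf (r i) ∣ p := by
          rw [orderOf_dvd_iff_pow_eq_one, r_pow, CharP.cast_eq_zero, mul_zero, r_zero]
        rw [← hg, MulEquiv.orderOf_eq, orderOf_sr, Nat.prime_dvd_prime_iff_eq Nat.prime_two hp] at h1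
        omega
      · exact ⟨i, rfl⟩
    have hconn : ∀ E : Finset ℕ, IsConnectionSet (ψ '' reflectionSet p E) := by
      intro E
      constructor
      · rintro ⟨g, hg, h1⟩
        rw [map_eq_one_iff ψ ψ.injective] at h1
        exact isConnectionSet_reflectionSet.one_notMem (h1 ▸ hg)
      · rintro _ ⟨g, hg, rfl⟩
        exact ⟨g⁻¹, isConnectionSet_reflectionSet.inv_mem g hg, map_inv ψ g⟩
    have hdeg : ∀ E : Finset ℕ, (∀ k ∈ E, k < 13) → E.card = 6 →
        (cayleyGraph (ψ '' reflectionSet p E)).IsRegularOfDegree 6 := by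
      intro E hE hcard x
      rw [(hconn E).degree_cayleyGraph, Set.ncard_image_of_injective _ ψ.injective,
        ncard_reflectionSet fun k hk => (hE k hk).trans_le h13, hcard]
    have hiso : ∀ E : Finset ℕ,
        Nonempty (cayleyGraph (reflectionSet p E) ≃g cayleyGraph (ψ '' reflectionSet p E)) :=
      fun E => ⟨cayleyGraphIsoOfMulEquiv ψ fun g => ψ.injective.mem_set_image⟩
    obtain ⟨e⟩ := hiso {0, 1, 2, 6, 8, 11}
    obtain ⟨e'⟩ := hiso {0, 2, 4, 5, 10, 11}
    subst hSψ hTψ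
    refine ⟨?_, hconn _, hconn _, hdeg _ (by decide) (by decide), hdeg _ (by decide) (by decide),
      e.symm.cospectral.trans ((cospectral_six_reflections h13).trans e'.cospectral), ⟨fun e₀ => ?_⟩⟩
    · rintro g (hg | hg)
      exacts [hrefl _ g hg, hrefl _ g hg]
    · exact (isEmpty_iso_six_reflections h13).false ((e.trans e₀).trans e'.symm)
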